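/- A partition into distinct parts is a finite set $\tilde\pi$ of positive integers (the empty partition is included); $|\tilde\pi|$ is the sum of its parts. A chain $\chi$ of $\tilde\pi$ is a maximal run of consecutive integers in $\tilde\pi$; let $s(\chi)$ be its least part and $l(\chi)$ its number of parts. For complex numbers $A,B,C$ put $$F_l(A,B,C)=\sum_{i+j+k=l}A^iB^jC^k+ABC\sum_{i+j+k=l-2}A^iB^jC^k+BC\sum_{j+k=l-1}B^jC^k ,$$ where all summation variables are integers $\ge 0$ (so that a sum over $i+j+k=n$ or $j+k=n$ with $n<0$ is $0$). For a chain $\chi$ with $l=l(\chi)$ define $$\omega(\chi)=\begin{cases}\displaystyle\sum_{i+j+k=l}A^iB^jC^k+ABC\sum_{i+j+k=l-2}A^iB^jC^k, & \text{if } s(\chi)=1,\\[2ex] F_l(A,B,C)+A(B+C)\,F_{l-1}(A,B,C)+A^2BC\,F_{l-2}(A,B,C), & \text{if } s(\chi)>1,\end{cases}$$ and let $\omega(\tilde\pi)=\prod_{\chi}\omega(\chi)$, the product being over all chains $\chi$ of $\tilde\pi$ (so $\omega(\emptyset)=1$). For $|q|<1$ write $(a;q)_\infty=\lim_{N\to\infty}\prod_{j=0}^{N-1}(1-aq^j)$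 and $(a_1,a_2,a_3;q)_\infty=(a_1;q)_\infty(a_2;q)_\infty(a_3;q)_\infty$. Let $D$ be the set of all partitions into distinct parts. Then for all complex $A,B,C,q$ with $|q|<1$ the limits $(a;q)_\infty$ exist for every complex $a$, the series below converges absolutely, and $$\sum_{\tilde\pi\in D}\omega(\tilde\pi)\,q^{|\tilde\pi|}=(-Aq,-Bq,-Cq;q)_\infty .$$ -/

import Mathlib

open Filter Topology

section Definitions

/-- The finite `q`-shifted factorial `(a;q)_N = ∏_{j=0}^{N-1} (1 - a q^j)`. -/
def qPochhammer {R : Type*} [CommRing R] (a q : R) (N : ℕ) : R :=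
  ∏ j ∈ Finset.range N, (1 - a * q ^ j)

/-- The infinite `q`-shifted factorial `(a;q)_∞ = lim_{N → ∞} (a;q)_N` (used for `|q| < 1`). -/
noncomputable def qPochhammerInf (a q : ℂ) : ℂ :=
  limUnder atTop (fun N : ℕ => qPochhammer a q N)

/-- `∑_{j+k=n} B^j C^k` over integers `j, k ≥ 0`; an empty sum if `n < 0`. -/
def homSum₂ {R : Type*} [CommSemiring R] (B C : R) : ℤ → R
  | .ofNat n => ∑ p ∈ Finset.HasAntidiagonal.antidiagonal n, B ^ p.1 * C ^ p.2
  | .negSucc _ => 0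

/-- `∑_{i+j+k=n} A^i B^j C^k` over integers `i, j, k ≥ 0`; an empty sum if `n < 0`. -/
def homSum₃ {R : Type*} [CommSemiring R] (A B C : R) : ℤ → R
  | .ofNat n => ∑ p ∈ Finset.HasAntidiagonal.antidiagonal n, ∑ r ∈ Finset.HasAntidiagonal.antidiagonal p.2,
      A ^ p.1 * B ^ r.1 * C ^ r.2
  | .negSucc _ => 0

/-- The polynomial
`F_l(A,B,C) = ∑_{i+j+k=l} A^i B^j C^k + ABC ∑_{i+j+k=l-2} A^i B^j C^k + BC ∑_{j+k=l-1} B^j C^k`. -/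
def chainF {R : Type*} [CommSemiring R] (A B C : R) (l : ℤ) : R :=
  homSum₃ A B C l + A * B * C * homSum₃ A B C (l - 2) + B * C * homSum₂ B C (l - 1)

/-- The weight `ω(χ)` of a chain `χ` with least part `s` and with `l` parts. -/
def chainWeight {R : Type*} [CommSemiring R] (A B C : R) (s l : ℕ) : R :=
  if s = 1 then
    homSum₃ A B C l + A * B * C * homSum₃ A B C ((l : ℤ) - 2)
  else
    chainF A B C l + A * (B + C) * chainF A B C ((l : ℤ) - 1)
      + A ^ 2 * B * C * chainF A B C ((l : ℤ) - 2)

/-- The chains of a finite set `S` of integers, that is, the maximal runs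
`s, s + 1, …, s + l - 1` (`l ≥ 1`) of consecutive integers in `S`. A chain is recorded as the
pair `(s, l)` of its least element and its length. -/
def chains (S : Finset ℕ) : Finset (ℕ × ℕ) :=
  (S ×ˢ Finset.Icc 1 S.card).filter fun c =>
    (∀ i < c.2, c.1 + i ∈ S) ∧ c.1 + c.2 ∉ S ∧ ∀ m ∈ S, m + 1 ≠ c.1

/-- The set `D` of all partitions (of all `n ≥ 0`) into distinct parts. -/
abbrev DistinctPartition : Type :=
  Σ n : ℕ, {p : n.Partition // p ∈ Nat.Partition.distincts n}

/-- The sum `|π|` of the parts of `π`. -/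
def DistinctPartition.size (π : DistinctPartition) : ℕ := π.2.1.parts.sum

/-- The weight `ω(π) = ∏_χ ω(χ)`, the product being over all chains `χ` of `π`. -/
def DistinctPartition.weight {R : Type*} [CommSemiring R] (A B C : R)
    (π : DistinctPartition) : R :=
  ∏ c ∈ chains π.2.1.parts.toFinset, chainWeight A B C c.1 c.2

end Definitions

/-! ### Shift operators on sequences -/

section Operators

/-! Let g_N be the generating function of the partitions with parts at most N. Splitting at the
largest missing element of {1, …, N} isolates the top chain and gives g = W₁(X) e₀ + W₂(X) S g. Here
X is the weighted shift, S the plain shift, e₀ = (1, 0, 0, …), and W₁, W₂ generate the weights of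
chains with s = 1 and s > 1. These series are rational with common denominator D =
(1-AX)(1-BX)(1-CX) and numerators 1+ABCX² and (1+ABX)(1+ACX)(1+BCX), whence
`boundedGF_shiftEquation`.

Since XS = qSX, moving S past a linear factor multiplies its coefficient by q. This links the
solutions g for (A, B, C) and g' for (A, B, Cq): (1+Cq)(1-CqX) g' = (1+BCqX)(1+ACqX) g + Cq e₀
(`ShiftEquation.contiguous`). As N → ∞ every term with X, and e₀, disappears, leaving G(A,B,C) =
(1+Cq) G(A,B,Cq) for the full generating function G. The functional equation is symmetric, so the
same holds in A and B. Iteration, continuity of G in the parameters and G(0,0,0) = 1 give the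
product. Absolute convergence and continuity come from a bound on ω exponential in the number of
parts. -/

/-- The shift `(S g)_n = g_{n-1}` on sequences. -/
def seqShift : Module.End ℂ (ℕ → ℂ) where
  toFun g n := if n = 0 then 0 else g (n - 1)
  map_add' f g := by ext n; simp only [Pi.add_apply]; split_ifs <;> simp
  map_smul' c g := by ext n; simp

/-- The weighted shift `(X g)_n = q ^ n g_{n-1}` on sequences. -/
def qShift (q : ℂ) : Module.End ℂ (ℕ → ℂ) where
  toFun g n := if n = 0 then 0 else q ^ n * g (n - 1)
  map_add' f g := by ext n; simp only [Pi.add_apply]; split_ifs <;> simp [mul_add]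
  map_smul' c g := by
    ext n
    simp only [Pi.smul_apply, smul_eq_mul, RingHom.id_apply]
    split_ifs <;> ring1

@[simp] lemma seqShift_zero (g : ℕ → ℂ) : seqShift g 0 = 0 := rfl
@[simp] lemma seqShift_succ (g : ℕ → ℂ) (n : ℕ) : seqShift g (n + 1) = g n := rfl
@[simp] lemma qShift_zero (q : ℂ) (g : ℕ → ℂ) : qShift q g 0 = 0 := rfl
@[simp] lemma qShift_succ (q : ℂ) (g : ℕ → ℂ) (n : ℕ) :
    qShift q g (n + 1) = q ^ (n + 1) * g n := rfl

/-- The polynomial `p` evaluated at the weighted shift. -/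
noncomputable def qShiftPoly (q : ℂ) : Polynomial ℂ →ₐ[ℂ] Module.End ℂ (ℕ → ℂ) :=
  Polynomial.aeval (qShift q)

/-- The linear polynomial `1 + a X`. -/
noncomputable def oneAdd (a : ℂ) : Polynomial ℂ := 1 + Polynomial.C a * Polynomial.X

lemma qShiftPoly_X (q : ℂ) (g : ℕ → ℂ) : qShiftPoly q Polynomial.X g = qShift q g := by
  simp [qShiftPoly]

lemma qShiftPoly_C (q a : ℂ) (g : ℕ → ℂ) : qShiftPoly q (Polynomial.C a) g = a • g := by
  simp [qShiftPoly]

lemma qShiftPoly_oneAdd (q a : ℂ) (g : ℕ → ℂ) :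
    qShiftPoly q (oneAdd a) g = g + a • qShift q g := by
  simp [qShiftPoly, oneAdd]

lemma qShiftPoly_mul (q : ℂ) (p r : Polynomial ℂ) (g : ℕ → ℂ) :
    qShiftPoly q (p * r) g = qShiftPoly q p (qShiftPoly q r g) := by
  simp [map_mul]

lemma qShiftPoly_add (q : ℂ) (p r : Polynomial ℂ) (g : ℕ → ℂ) :
    qShiftPoly q (p + r) g = qShiftPoly q p g + qShiftPoly q r g := by
  simp [map_add]

/-- This is XS = qSX, the only failure of commutativity and the source of the parameter change C ↦
Cq. -/
lemma oneAdd_seqShift (q a : ℂ) (g : ℕ → ℂ) :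
    qShiftPoly q (oneAdd a) (seqShift g) = seqShift (qShiftPoly q (oneAdd (a * q)) g) := by
  rw [qShiftPoly_oneAdd, qShiftPoly_oneAdd]
  ext n
  rcases n with _ | _ | n
  · simp
  · simp
  · simp only [Pi.add_apply, Pi.smul_apply, smul_eq_mul, qShift_succ, seqShift_succ]
    ring

/-- The sequence `1, 0, 0, …`. -/
def seqOne : ℕ → ℂ := Pi.single 0 1

lemma qShift_seqOne (q : ℂ) : qShift q seqOne = q • seqShift seqOne := by
  ext n
  rcases n with _ | _ | n <;> simp [seqOne]

/-- Sequences whose first `N` terms vanish. -/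
def VanishBelow (N : ℕ) (u : ℕ → ℂ) : Prop := ∀ m < N, u m = 0

lemma VanishBelow.qShift {N : ℕ} {u : ℕ → ℂ} (h : VanishBelow N u) (q : ℂ) :
    VanishBelow (N + 1) (qShift q u) := by
  rintro (_ | m) hm
  · rfl
  · simp [h m (by omega)]

lemma VanishBelow.seqShift {N : ℕ} {u : ℕ → ℂ} (h : VanishBelow N u) :
    VanishBelow (N + 1) (seqShift u) := by
  rintro (_ | m) hm
  · rfl
  · simp [h m (by omega)]

lemma VanishBelow.mono {N M : ℕ} {u : ℕ → ℂ} (h : VanishBelow N u) (hM : M ≤ N) :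
    VanishBelow M u := fun m hm => h m (by omega)

lemma VanishBelow.qShiftPoly {N : ℕ} {u : ℕ → ℂ} (h : VanishBelow N u) (q : ℂ)
    (p : Polynomial ℂ) : VanishBelow N (qShiftPoly q p u) := by
  induction p using Polynomial.induction_on' with
  | add p r hp hr =>
    intro m hm
    simp [map_add, hp m hm, hr m hm]
  | monomial n a =>
    rw [← Polynomial.C_mul_X_pow_eq_monomial, qShiftPoly_mul, qShiftPoly_C]
    suffices VanishBelow N (_root_.qShiftPoly q (Polynomial.X ^ n) u) by
      intro m hm
      rw [Pi.smul_apply, this m hm, smul_zero]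
    induction n with
    | zero => simpa using h
    | succ n ih =>
      rw [pow_succ', qShiftPoly_mul, qShiftPoly_X]
      exact (ih.qShift q).mono (by omega)

/-- Both X and S raise the order of vanishing by one, so the equation forces u to vanish to every
order. -/
lemma eq_zero_of_shift_equation {q : ℂ} (p r : Polynomial ℂ) {u : ℕ → ℂ}
    (h : qShiftPoly q (1 + p * Polynomial.X) u = qShiftPoly q r (seqShift u)) : u = 0 := by
  have key : ∀ N, VanishBelow N u := by
    intro N
    induction N with
    | zero => intro m hm; omega
    | succ N ih =>
      intro m hm
      have h1 := congrFun h m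
      rw [qShiftPoly_add, qShiftPoly_mul, qShiftPoly_X] at h1
      have h2 := (ih.qShift q).qShiftPoly q p m hm
      have h3 := ih.seqShift.qShiftPoly q r m hm
      simpa [h2, h3] using h1
  ext n
  exact key (n + 1) n (by omega)

/-! ### The functional equation and its contiguous relation -/

/-- The functional equation of the generating functions of partitions with bounded parts. -/
def ShiftEquation (q A B C : ℂ) (g : ℕ → ℂ) : Prop :=
  qShiftPoly q (oneAdd (-A) * oneAdd (-B) * oneAdd (-C)) g =
    qShiftPoly q (oneAdd (A * B) * oneAdd (A * C) * oneAdd (B * C)) (seqShift g) +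
      qShiftPoly q (1 + Polynomial.C (A * B * C) * Polynomial.X ^ 2) seqOne

/-- The symmetry in A, B, C, hidden in the definition of the weights, is visible in the functional
equation. -/
lemma ShiftEquation.swap₂₃ {q A B C : ℂ} {g : ℕ → ℂ} (h : ShiftEquation q A B C g) :
    ShiftEquation q A C B g := by
  unfold ShiftEquation at *
  rw [mul_right_comm (oneAdd (-A)), mul_comm (oneAdd (A * C)), mul_comm C B, mul_right_comm A C B]
  exact h

lemma ShiftEquation.swap₁₂ {q A B C : ℂ} {g : ℕ → ℂ} (h : ShiftEquation q A B C g) :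
    ShiftEquation q B A C g := by
  unfold ShiftEquation at *
  rw [mul_comm (oneAdd (-B)), mul_comm B A, mul_right_comm (oneAdd (A * B))]
  exact h

/-- Both sides solve one equation D u = R(1+ABX) S u + (source), with the same source, and such a
solution is unique. -/
lemma ShiftEquation.contiguous {q A B C : ℂ} {g g' : ℕ → ℂ} (h : ShiftEquation q A B C g)
    (h' : ShiftEquation q A B (C * q) g') :
    (1 + C * q) • qShiftPoly q (oneAdd (-(C * q))) g' =
      qShiftPoly q (oneAdd (B * C * q) * oneAdd (A * C * q)) g + (C * q) • seqOne := by
  obtain ⟨D, hD⟩ : ∃ D, D = oneAdd (-A) * oneAdd (-B) * oneAdd (-C) := ⟨_, rfl⟩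
  obtain ⟨R, hR⟩ : ∃ R, R = oneAdd (B * C * q) * oneAdd (A * C * q) := ⟨_, rfl⟩
  obtain ⟨r, hr⟩ : ∃ r : Polynomial ℂ,
      r = 1 + Polynomial.C (A * B * C) * Polynomial.X ^ 2 := ⟨_, rfl⟩
  obtain ⟨r', hr'⟩ : ∃ r : Polynomial ℂ,
      r = 1 + Polynomial.C (A * B * (C * q)) * Polynomial.X ^ 2 := ⟨_, rfl⟩
  unfold ShiftEquation at h h'
  rw [← hD, ← hr] at h
  rw [← hr'] at h'
  rw [← hR]
  have e1 : qShiftPoly q D (qShiftPoly q R g) =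
      qShiftPoly q (R * oneAdd (A * B)) (seqShift (qShiftPoly q R g)) +
      qShiftPoly q (R * r) seqOne := by
    have hS : seqShift (qShiftPoly q R g) =
        qShiftPoly q (oneAdd (B * C) * oneAdd (A * C)) (seqShift g) := by
      rw [hR, qShiftPoly_mul, ← oneAdd_seqShift, ← oneAdd_seqShift, ← qShiftPoly_mul]
    have hp : R * oneAdd (A * B) * (oneAdd (B * C) * oneAdd (A * C)) =
        R * (oneAdd (A * B) * oneAdd (A * C) * oneAdd (B * C)) := by ring
    rw [← qShiftPoly_mul, mul_comm D R, qShiftPoly_mul, h, map_add, hS, ← qShiftPoly_mul,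
      ← qShiftPoly_mul, ← qShiftPoly_mul, hp]
  have e2 : qShiftPoly q D (qShiftPoly q (oneAdd (-(C * q))) g') =
      qShiftPoly q (R * oneAdd (A * B)) (seqShift (qShiftPoly q (oneAdd (-(C * q))) g')) +
      qShiftPoly q (oneAdd (-C) * r') seqOne := by
    have hS : seqShift (qShiftPoly q (oneAdd (-(C * q))) g') =
        qShiftPoly q (oneAdd (-C)) (seqShift g') := by
      rw [← neg_mul, ← oneAdd_seqShift]
    have hp : D * oneAdd (-(C * q)) =
        oneAdd (-C) * (oneAdd (-A) * oneAdd (-B) * oneAdd (-(C * q))) := by rw [hD]; ring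
    have hp' : R * oneAdd (A * B) * oneAdd (-C) =
        oneAdd (-C) * (oneAdd (A * B) * oneAdd (A * (C * q)) * oneAdd (B * (C * q))) := by
      rw [hR, ← mul_assoc A, ← mul_assoc B]; ring
    rw [← qShiftPoly_mul, hp, qShiftPoly_mul, h', map_add, hS, ← qShiftPoly_mul,
      ← qShiftPoly_mul, ← qShiftPoly_mul, hp']
  -- The term Cq e₀ accounts exactly for the difference of the sources in `e1` and `e2`. Since X e₀
  -- = q S e₀, its shift is CX e₀, and the claim becomes the polynomial identity `hp`.
  have e3 : qShiftPoly q D ((C * q) • seqOne) =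
      qShiftPoly q (R * oneAdd (A * B)) (seqShift ((C * q) • seqOne)) +
      ((1 + C * q) • qShiftPoly q (oneAdd (-C) * r') seqOne - qShiftPoly q (R * r) seqOne) := by
    have s : seqShift ((C * q) • seqOne) =
        qShiftPoly q (Polynomial.C C * Polynomial.X) seqOne := by
      rw [qShiftPoly_mul, qShiftPoly_X, qShiftPoly_C, qShift_seqOne, map_smul, mul_smul]
    have hp : D * Polynomial.C (C * q) + R * r =
        R * oneAdd (A * B) * (Polynomial.C C * Polynomial.X) +
          Polynomial.C (1 + C * q) * (oneAdd (-C) * r') := by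
      simp only [hD, hR, hr, hr', oneAdd, map_add, map_mul, map_neg, map_one]
      ring
    rw [s, ← qShiftPoly_C q (C * q), ← qShiftPoly_mul, ← qShiftPoly_mul,
      ← qShiftPoly_C q (1 + C * q), ← qShiftPoly_mul, ← add_sub_assoc, ← qShiftPoly_add, ← hp,
      qShiftPoly_add, add_sub_cancel_right]
  rw [← sub_eq_zero]
  -- The first polynomial is (D - 1)/X.
  refine eq_zero_of_shift_equation (q := q)
    (Polynomial.C (-A - B - C) + Polynomial.C (A * B + A * C + B * C) * Polynomial.X -
      Polynomial.C (A * B * C) * Polynomial.X ^ 2) (R * oneAdd (A * B)) ?_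
  have hD' : (1 + (Polynomial.C (-A - B - C) + Polynomial.C (A * B + A * C + B * C) *
      Polynomial.X - Polynomial.C (A * B * C) * Polynomial.X ^ 2) * Polynomial.X) = D := by
    simp only [hD, oneAdd, map_add, map_mul, map_neg, map_sub]
    ring
  rw [hD', map_sub, map_add, map_smul, e1, e2, e3]
  simp only [map_sub, map_add, map_smul, smul_add]
  abel

/-! ### Passage to the limit in the contiguous relation -/

lemma tendsto_qShift {q : ℂ} (hq : ‖q‖ < 1) {g : ℕ → ℂ} {a : ℂ} (h : Tendsto g atTop (𝓝 a)) :
    Tendsto (qShift q g) atTop (𝓝 0) := by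
  rw [← tendsto_add_atTop_iff_nat 1]
  simp only [qShift_succ]
  simpa using ((tendsto_add_atTop_iff_nat 1).2 (tendsto_pow_atTop_nhds_zero_of_norm_lt_one hq)).mul h

lemma tendsto_oneAdd {q : ℂ} (hq : ‖q‖ < 1) (c : ℂ) {g : ℕ → ℂ} {a : ℂ}
    (h : Tendsto g atTop (𝓝 a)) : Tendsto (qShiftPoly q (oneAdd c) g) atTop (𝓝 a) := by
  rw [qShiftPoly_oneAdd]
  have := h.add ((tendsto_qShift hq h).const_smul c)
  rw [smul_zero, add_zero] at this
  exact this

lemma ShiftEquation.limit_eq {q A B C : ℂ} (hq : ‖q‖ < 1) {g g' : ℕ → ℂ} {a a' : ℂ}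
    (h : ShiftEquation q A B C g) (h' : ShiftEquation q A B (C * q) g')
    (hg : Tendsto g atTop (𝓝 a)) (hg' : Tendsto g' atTop (𝓝 a')) : a = (1 + C * q) * a' := by
  have e := h.contiguous h'
  have t1 := (tendsto_oneAdd hq (-(C * q)) hg').const_smul (1 + C * q)
  have t2 := tendsto_oneAdd hq (B * C * q) (tendsto_oneAdd hq (A * C * q) hg)
  have t3 : Tendsto ((C * q) • seqOne) atTop (𝓝 0) := by
    refine tendsto_const_nhds.congr' ?_
    filter_upwards [eventually_ge_atTop 1] with n hn
    simp [seqOne, show n ≠ 0 by omega]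
  rw [← qShiftPoly_mul] at t2
  have t4 := t2.add t3
  rw [add_zero] at t4
  refine tendsto_nhds_unique t4 (t1.congr fun n => ?_)
  exact congrFun e n

lemma ShiftEquation.eq_one {q : ℂ} {g : ℕ → ℂ} (h : ShiftEquation q 0 0 0 g) (n : ℕ) :
    g n = 1 := by
  have h0 : g = seqShift g + seqOne := by
    simpa [ShiftEquation, oneAdd] using h
  induction n with
  | zero => rw [h0]; simp [seqOne]
  | succ n ih => rw [h0]; simp [seqOne, ih]

end Operators

/-! ### Chains and the recursion at the largest missing part -/

section Chains

lemma mem_chains {S : Finset ℕ} {a b : ℕ} :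
    (a, b) ∈ chains S ↔ 1 ≤ b ∧ (∀ i < b, a + i ∈ S) ∧ a + b ∉ S ∧ ∀ m ∈ S, m + 1 ≠ a := by
  simp only [chains, Finset.mem_filter, Finset.mem_product, Finset.mem_Icc]
  constructor
  · rintro ⟨⟨-, h, -⟩, h'⟩
    exact ⟨h, h'⟩
  · rintro ⟨h, h'⟩
    refine ⟨⟨h'.1 0 (by omega), h, ?_⟩, h'⟩
    have : (Finset.range b).image (a + ·) ⊆ S := by
      intro x hx
      obtain ⟨i, hi, rfl⟩ := Finset.mem_image.1 hx
      exact h'.1 i (Finset.mem_range.1 hi)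
    have h2 := Finset.card_le_card this
    rwa [Finset.card_image_of_injective _ (add_right_injective a), Finset.card_range] at h2

/-- The missing element s - 1 keeps the new run from merging with a chain of S. -/
lemma chains_union_Ico {S : Finset ℕ} {s l : ℕ} (hl : 0 < l) (hS : ∀ x ∈ S, x + 1 < s) :
    chains (S ∪ Finset.Ico s (s + l)) = insert (s, l) (chains S) := by
  ext ⟨a, b⟩
  simp only [Finset.mem_insert, mem_chains, Finset.mem_union, Finset.mem_Ico, Prod.mk.injEq]
  constructor
  · rintro ⟨hb, hi, he, hm⟩
    have ha := hi 0 (by omega)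
    rw [add_zero] at ha
    rcases ha with ha | ha
    · right
      refine ⟨hb, ?_, fun h => he (Or.inl h), fun m h => hm m (Or.inl h)⟩
      intro i
      induction i with
      | zero => exact fun _ => ha
      | succ i ih =>
        intro hib
        have h1 := hS _ (ih (by omega))
        rcases hi (i + 1) hib with h2 | h2
        · exact h2
        · omega
    · left
      have has : a = s := by
        by_contra hne
        exact hm (a - 1) (Or.inr (by omega)) (by omega)
      subst has
      refine ⟨rfl, ?_⟩
      rcases lt_trichotomy b l with h | h | h
      · exact absurd (Or.inr (by omega)) he
      · exact h
      · rcases hi l h with h1 | h1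
        · have := hS _ h1
          omega
        · omega
  · rintro (⟨rfl, rfl⟩ | ⟨hb, hi, he, hm⟩)
    · refine ⟨hl, fun i hi => Or.inr (by omega), ?_, ?_⟩
      · rintro (h | h)
        · have := hS _ h
          omega
        · omega
      · rintro m (h | h)
        · have := hS _ h
          omega
        · omega
    · have h1 := hS _ (hi 0 (by omega))
      have h2 := hS _ (hi (b - 1) (by omega))
      refine ⟨hb, fun i h => Or.inl (hi i h), ?_, ?_⟩
      · rintro (h | h)
        · exact he h
        · omega
      · rintro m (h | h)
        · exact hm m h
        · omega

lemma chains_empty : chains ∅ = ∅ := by simp [chains]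

/-- The product of the weights of the chains of a finite set. -/
def finsetWeight (A B C : ℂ) (S : Finset ℕ) : ℂ :=
  ∏ c ∈ chains S, chainWeight A B C c.1 c.2

/-- Covers an empty top run, which occurs when N itself is missing. -/
lemma chainWeight_zero (A B C : ℂ) (s : ℕ) : chainWeight A B C s 0 = 1 := by
  have h1 : ((0 : ℕ) : ℤ) - 2 = Int.negSucc 1 := rfl
  have h2 : ((0 : ℕ) : ℤ) - 1 = Int.negSucc 0 := rfl
  have h3 : Int.negSucc 1 - 1 = Int.negSucc 2 := rfl
  have h4 : Int.negSucc 0 - 2 = Int.negSucc 2 := rfl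
  have h5 : Int.negSucc 0 - 1 = Int.negSucc 1 := rfl
  have h6 : Int.negSucc 1 - 2 = Int.negSucc 3 := rfl
  have h0 : homSum₃ A B C ((0 : ℕ) : ℤ) = 1 := by
    change homSum₃ A B C (Int.ofNat 0) = 1
    simp [homSum₃]
  rw [chainWeight, chainF, chainF, chainF, h1, h2, h3, h4, h5, h6, h0]
  simp [homSum₃, homSum₂]

lemma finsetWeight_union_Ico (A B C : ℂ) {S : Finset ℕ} {s : ℕ} (l : ℕ)
    (hS : ∀ x ∈ S, x + 1 < s) :
    finsetWeight A B C (S ∪ Finset.Ico s (s + l)) =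
      chainWeight A B C s l * finsetWeight A B C S := by
  rcases Nat.eq_zero_or_pos l with rfl | hl
  · simp [chainWeight_zero]
  · rw [finsetWeight, chains_union_Ico hl hS, Finset.prod_insert, finsetWeight]
    intro h
    have := hS _ ((mem_chains.1 h).2.1 0 hl)
    omega

lemma finsetWeight_Ico_one (A B C : ℂ) (N : ℕ) :
    finsetWeight A B C (Finset.Ico 1 (N + 1)) = chainWeight A B C 1 N := by
  have := finsetWeight_union_Ico A B C (S := ∅) (s := 1) N (by simp)
  rw [Finset.empty_union, add_comm 1 N] at this
  simpa [finsetWeight, chains_empty] using this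

/-- A sum over all subsets of `{1, …, N}`, arranged by the largest missing element. -/
lemma sum_powerset_Ico {M : Type*} [AddCommMonoid M] (g : Finset ℕ → M) (N : ℕ) :
    ∑ S ∈ (Finset.Ico 1 (N + 1)).powerset, g S = g (Finset.Ico 1 (N + 1)) +
      ∑ m ∈ Finset.range N, ∑ S ∈ (Finset.Ico 1 (m + 1)).powerset,
        g (S ∪ Finset.Ico (m + 2) (N + 1)) := by
  induction N generalizing g with
  | zero => simp
  | succ N ih =>
    have h1 : ∀ m ≤ N + 1, Finset.Ico m (N + 1 + 1) = insert (N + 1) (Finset.Ico m (N + 1)) := by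
      intro m hm
      ext x
      simp only [Finset.mem_insert, Finset.mem_Ico]
      omega
    rw [h1 1 (by omega), Finset.sum_powerset_insert (by simp), ih (fun S => g (insert (N + 1) S)),
      Finset.sum_range_succ]
    have h2 : ∀ m ∈ Finset.range N, ∑ S ∈ (Finset.Ico 1 (m + 1)).powerset,
        g (insert (N + 1) (S ∪ Finset.Ico (m + 2) (N + 1))) =
        ∑ S ∈ (Finset.Ico 1 (m + 1)).powerset, g (S ∪ Finset.Ico (m + 2) (N + 1 + 1)) := by
      intro m hm
      rw [h1 (m + 2) (by have := Finset.mem_range.1 hm; omega)]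
      simp only [Finset.union_insert]
    rw [Finset.sum_congr rfl h2]
    simp only [Finset.Ico_eq_empty_of_le (show N + 1 + 1 ≤ N + 2 by omega), Finset.union_empty]
    abel

/-- The generating function of the partitions with distinct parts not exceeding `N`. -/
def boundedGF (q A B C : ℂ) (N : ℕ) : ℂ :=
  ∑ S ∈ (Finset.Ico 1 (N + 1)).powerset, finsetWeight A B C S * q ^ (∑ i ∈ S, i)

/-- If m + 1 is the largest missing element, the top chain is m + 2, …, N and the parts below range
freely over {1, …, m}. -/
lemma boundedGF_eq (q A B C : ℂ) (N : ℕ) :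
    boundedGF q A B C N = chainWeight A B C 1 N * q ^ (∑ i ∈ Finset.Ico 1 (N + 1), i) +
      ∑ m ∈ Finset.range N, chainWeight A B C (m + 2) (N - 1 - m) *
        q ^ (∑ i ∈ Finset.Ico (m + 2) (N + 1), i) * boundedGF q A B C m := by
  rw [boundedGF, sum_powerset_Ico, finsetWeight_Ico_one]
  congr 1
  refine Finset.sum_congr rfl fun m hm => ?_
  rw [boundedGF, Finset.mul_sum]
  refine Finset.sum_congr rfl fun S hS => ?_
  have hmN := Finset.mem_range.1 hm
  have hS' : ∀ x ∈ S, x < m + 1 := fun x hx =>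
    (Finset.mem_Ico.1 (Finset.mem_powerset.1 hS hx)).2
  have hN : N + 1 = m + 2 + (N - 1 - m) := by omega
  have hd : Disjoint S (Finset.Ico (m + 2) (N + 1)) := by
    rw [Finset.disjoint_left]
    intro x hx hx'
    have := hS' x hx
    have := (Finset.mem_Ico.1 hx').1
    omega
  rw [Finset.sum_union hd, pow_add]
  nth_rw 1 [hN]
  rw [finsetWeight_union_Ico _ _ _ _ (fun x hx => by have := hS' x hx; omega)]
  ring

end Chains

/-! ### Generating series of the chain weights -/

section Series

open PowerSeries

/-- The series `∑ c_l X ^ l` in the weighted shift, applied to a sequence. -/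
noncomputable def qConv (q : ℂ) (c : PowerSeries ℂ) (g : ℕ → ℂ) (N : ℕ) : ℂ :=
  ∑ p ∈ Finset.HasAntidiagonal.antidiagonal N,
    coeff p.1 c * q ^ (∑ i ∈ Finset.Ico (p.2 + 1) (N + 1), i) * g p.2

lemma qConv_add (q : ℂ) (c d : PowerSeries ℂ) (g : ℕ → ℂ) :
    qConv q (c + d) g = qConv q c g + qConv q d g := by
  ext N
  simp only [qConv, Pi.add_apply, ← Finset.sum_add_distrib, map_add, add_mul]

lemma qConv_C_mul (q a : ℂ) (c : PowerSeries ℂ) (g : ℕ → ℂ) :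
    qConv q (C a * c) g = a • qConv q c g := by
  ext N
  simp only [qConv, Pi.smul_apply, smul_eq_mul, Finset.mul_sum, coeff_C_mul, mul_assoc]

lemma qConv_X_mul (q : ℂ) (c : PowerSeries ℂ) (g : ℕ → ℂ) :
    qConv q (X * c) g = qShift q (qConv q c g) := by
  ext N
  cases N with
  | zero => simp [qConv]
  | succ N =>
    rw [qShift_succ, qConv, Finset.Nat.sum_antidiagonal_succ, qConv, Finset.mul_sum]
    simp only [coeff_zero_X_mul, zero_mul, zero_add, coeff_succ_X_mul]
    refine Finset.sum_congr rfl fun p hp => ?_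
    have := Finset.HasAntidiagonal.mem_antidiagonal.1 hp
    rw [Finset.sum_Ico_succ_top (by omega : p.2 + 1 ≤ N + 1), pow_add]
    ring

lemma qConv_one (q : ℂ) (g : ℕ → ℂ) : qConv q 1 g = g := by
  ext N
  rw [qConv, Finset.sum_eq_single (0, N)]
  · simp
  · rintro ⟨a, b⟩ hp hne
    have h := Finset.HasAntidiagonal.mem_antidiagonal.1 hp
    have : a ≠ 0 := by
      rintro rfl
      simp at h
      exact hne (by rw [h])
    simp [coeff_one, this]
  · simp

lemma qConv_poly_mul (q : ℂ) (p : Polynomial ℂ) (c : PowerSeries ℂ) (g : ℕ → ℂ) :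
    qConv q (p * c) g = qShiftPoly q p (qConv q c g) := by
  induction p using Polynomial.induction_on' with
  | add p r hp hr => rw [Polynomial.coe_add, add_mul, qConv_add, hp, hr, qShiftPoly_add]
  | monomial n a =>
    rw [← Polynomial.C_mul_X_pow_eq_monomial, qShiftPoly_mul, qShiftPoly_C, Polynomial.coe_mul,
      Polynomial.coe_C, mul_assoc, qConv_C_mul]
    congr 1
    induction n with
    | zero => simp
    | succ n ih =>
      rw [pow_succ', Polynomial.coe_mul, Polynomial.coe_X, mul_assoc, qConv_X_mul, ih,
        qShiftPoly_mul, qShiftPoly_X]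

lemma qConv_poly (q : ℂ) (p : Polynomial ℂ) (g : ℕ → ℂ) : qConv q p g = qShiftPoly q p g := by
  have := qConv_poly_mul q p 1 g
  rwa [mul_one, qConv_one] at this

/-- The generating series of `homSum₂`. -/
noncomputable def homSeries₂ (B C : ℂ) : PowerSeries ℂ := mk fun n => homSum₂ B C n

/-- The generating series of `homSum₃`. -/
noncomputable def homSeries₃ (A B C : ℂ) : PowerSeries ℂ := mk fun n => homSum₃ A B C n

lemma mk_pow_mul_one_sub (a : ℂ) : mk (fun n => a ^ n) * (1 - C a * X) = 1 := by
  rw [mul_sub, mul_one, ← mul_assoc, mul_comm _ (C a)]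
  ext n
  cases n with
  | zero => simp
  | succ n => simp [coeff_succ_mul_X, coeff_one, pow_succ']

lemma homSeries₂_eq (B C : ℂ) :
    homSeries₂ B C = mk (fun n => B ^ n) * mk (fun n => C ^ n) := by
  ext n
  rw [homSeries₂, coeff_mk, coeff_mul]
  simp only [coeff_mk]
  rfl

lemma homSeries₃_eq (A B C : ℂ) :
    homSeries₃ A B C = mk (fun n => A ^ n) * homSeries₂ B C := by
  ext n
  rw [homSeries₃, coeff_mk, coeff_mul]
  simp only [coeff_mk, homSeries₂]
  change ∑ p ∈ _, _ = _
  refine Finset.sum_congr rfl fun p _ => ?_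
  change _ = A ^ p.1 * ∑ r ∈ _, _
  rw [Finset.mul_sum]
  simp only [mul_assoc]

lemma mk_sub_eq (f : ℤ → ℂ) (hf : ∀ n, f (Int.negSucc n) = 0) (k : ℕ) :
    mk (fun n : ℕ => f ((n : ℤ) - k)) = X ^ k * mk (fun n : ℕ => f n) := by
  ext n
  rw [coeff_mk, coeff_X_pow_mul']
  split_ifs with h
  · rw [coeff_mk, Nat.cast_sub h]
  · obtain ⟨m, hm⟩ := Int.eq_negSucc_of_lt_zero (show (n : ℤ) - k < 0 by omega)
    rw [hm, hf]

lemma chainF_negSucc (A B C : ℂ) (n : ℕ) : chainF A B C (Int.negSucc n) = 0 := by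
  have h1 : Int.negSucc n - 2 = Int.negSucc (n + 2) := by omega
  have h2 : Int.negSucc n - 1 = Int.negSucc (n + 1) := by omega
  rw [chainF, h1, h2]
  simp [homSum₂, homSum₃]

lemma mk_chainWeight_one (A B C' : ℂ) : mk (fun l => chainWeight A B C' 1 l) =
    (1 + C (A * B * C') * X ^ 2) * homSeries₃ A B C' := by
  have h := mk_sub_eq (homSum₃ A B C') (fun _ => rfl) 2
  rw [add_mul, one_mul, mul_assoc, homSeries₃, ← h]
  ext n
  rw [map_add, coeff_C_mul, coeff_mk, coeff_mk, coeff_mk]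
  simp [chainWeight]

lemma mk_chainF (A B C' : ℂ) : mk (fun l : ℕ => chainF A B C' l) =
    (1 + C (A * B * C') * X ^ 2) * homSeries₃ A B C' + C (B * C') * X * homSeries₂ B C' := by
  have h := mk_sub_eq (homSum₃ A B C') (fun _ => rfl) 2
  have h' := mk_sub_eq (homSum₂ B C') (fun _ => rfl) 1
  rw [pow_one] at h'
  rw [add_mul, one_mul, mul_assoc, homSeries₃, ← h, mul_assoc (C (B * C')), homSeries₂, ← h']
  ext n
  simp only [map_add, coeff_mk, coeff_C_mul, chainF]
  simp

lemma mk_chainWeight (A B C' : ℂ) {s : ℕ} (hs : s ≠ 1) :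
    mk (fun l => chainWeight A B C' s l) =
      (1 + C (A * (B + C')) * X + C (A ^ 2 * B * C') * X ^ 2) *
        mk (fun l : ℕ => chainF A B C' l) := by
  have h := mk_sub_eq (chainF A B C') (chainF_negSucc A B C') 2
  have h' := mk_sub_eq (chainF A B C') (chainF_negSucc A B C') 1
  rw [pow_one] at h'
  rw [add_mul, add_mul, one_mul, mul_assoc, mul_assoc, ← h, ← h']
  ext n
  simp only [map_add, coeff_mk, coeff_C_mul, chainWeight, if_neg hs]
  simp

/-- The complete homogeneous sums have generating series 1/D. -/
lemma chainWeight_series_one (A B C' : ℂ) :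
    ((oneAdd (-A) * oneAdd (-B) * oneAdd (-C') : Polynomial ℂ) : PowerSeries ℂ) *
      mk (fun l => chainWeight A B C' 1 l) =
      ((1 + Polynomial.C (A * B * C') * Polynomial.X ^ 2 : Polynomial ℂ) : PowerSeries ℂ) := by
  rw [mk_chainWeight_one, homSeries₃_eq, homSeries₂_eq]
  simp only [oneAdd, Polynomial.coe_mul, Polynomial.coe_add, Polynomial.coe_C, Polynomial.coe_X,
    Polynomial.coe_one, Polynomial.coe_pow]
  have hA := mk_pow_mul_one_sub A
  have hB := mk_pow_mul_one_sub B
  have hC := mk_pow_mul_one_sub C'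
  rw [map_neg, map_neg, map_neg]
  generalize mk (fun n => A ^ n) = a at *
  generalize mk (fun n => B ^ n) = b at *
  generalize mk (fun n => C' ^ n) = c at *
  calc _ = (1 + C (A * B * C') * X ^ 2) * (a * (1 - C A * X)) * (b * (1 - C B * X)) *
      (c * (1 - C C' * X)) := by ring
    _ = _ := by rw [hA, hB, hC]; ring

/-- Multiplied by D, the series of `chainF` becomes 1 + ABCX² + BCX(1-AX) = 1 + BCX; the remaining
factor 1 + A(B+C)X + A²BCX² is (1+ABX)(1+ACX). -/
lemma chainWeight_series (A B C' : ℂ) {s : ℕ} (hs : s ≠ 1) :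
    ((oneAdd (-A) * oneAdd (-B) * oneAdd (-C') : Polynomial ℂ) : PowerSeries ℂ) *
      mk (fun l => chainWeight A B C' s l) =
      ((oneAdd (A * B) * oneAdd (A * C') * oneAdd (B * C') : Polynomial ℂ) : PowerSeries ℂ) := by
  rw [mk_chainWeight _ _ _ hs, mk_chainF, homSeries₃_eq, homSeries₂_eq]
  simp only [oneAdd, Polynomial.coe_mul, Polynomial.coe_add, Polynomial.coe_C, Polynomial.coe_X,
    Polynomial.coe_one]
  have hA := mk_pow_mul_one_sub A
  have hB := mk_pow_mul_one_sub B
  have hC := mk_pow_mul_one_sub C'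
  rw [map_neg, map_neg, map_neg]
  generalize mk (fun n => A ^ n) = a at *
  generalize mk (fun n => B ^ n) = b at *
  generalize mk (fun n => C' ^ n) = c at *
  calc _ = (1 + C (A * (B + C')) * X + C (A ^ 2 * B * C') * X ^ 2) *
      ((1 + C (A * B * C') * X ^ 2) * (a * (1 - C A * X)) + C (B * C') * X * (1 - C A * X)) *
      (b * (1 - C B * X)) * (c * (1 - C C' * X)) := by ring
    _ = _ := by
      rw [hA, hB, hC]
      simp only [map_mul, map_add, map_pow]
      ring

lemma boundedGF_eq_qConv (q A B C : ℂ) :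
    boundedGF q A B C = qConv q (mk fun l => chainWeight A B C 1 l) seqOne +
      qConv q (mk fun l => chainWeight A B C 2 l) (seqShift (boundedGF q A B C)) := by
  ext N
  rw [boundedGF_eq, Pi.add_apply]
  congr 1
  · rw [qConv, Finset.sum_eq_single (N, 0)]
    · simp [seqOne]
    · rintro ⟨a, b⟩ hp hne
      have h := Finset.HasAntidiagonal.mem_antidiagonal.1 hp
      have : b ≠ 0 := by
        rintro rfl
        simp at h
        exact hne (by rw [h])
      simp [seqOne, this]
    · simp
  · cases N with
    | zero => simp [qConv]
    | succ N =>
      rw [qConv, Finset.Nat.sum_antidiagonal_succ', Finset.Nat.sum_antidiagonal_eq_sum_range_succ_mk,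
        ← Finset.sum_range_reflect]
      simp only [seqShift_zero, mul_zero, zero_add, coeff_mk, seqShift_succ]
      refine Finset.sum_congr rfl fun m hm => ?_
      have := Finset.mem_range.1 hm
      have h2 : N - (N - m) = m := by omega
      -- The weight depends on s only through whether s = 1, so 2 may stand for m + 2.
      simp [chainWeight, h2]

theorem boundedGF_shiftEquation (q A B C : ℂ) : ShiftEquation q A B C (boundedGF q A B C) := by
  unfold ShiftEquation
  nth_rw 1 [boundedGF_eq_qConv]
  rw [map_add, ← qConv_poly_mul, ← qConv_poly_mul, chainWeight_series_one,
    chainWeight_series _ _ _ (by norm_num), qConv_poly, qConv_poly, add_comm]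

end Series

/-! ### Exponential bounds for the weights -/

section Bounds

lemma natCast_succ_le_two_pow (n : ℕ) : (n : ℝ) + 1 ≤ 2 ^ n := by
  exact_mod_cast Nat.lt_two_pow_self

lemma norm_homSum₂_le {M : ℝ} {B C : ℂ} (hB : ‖B‖ ≤ M) (hC : ‖C‖ ≤ M) (n : ℕ) :
    ‖homSum₂ B C n‖ ≤ (2 * M) ^ n := by
  have hM : 0 ≤ M := (norm_nonneg _).trans hB
  change ‖∑ p ∈ Finset.HasAntidiagonal.antidiagonal n, B ^ p.1 * C ^ p.2‖ ≤ _
  calc _ ≤ ∑ p ∈ Finset.HasAntidiagonal.antidiagonal n, M ^ n := by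
        refine norm_sum_le_of_le _ fun p hp => ?_
        rw [← Finset.HasAntidiagonal.mem_antidiagonal.1 hp, pow_add, norm_mul, norm_pow, norm_pow]
        gcongr
    _ = ((n : ℝ) + 1) * M ^ n := by simp
    _ ≤ 2 ^ n * M ^ n := by gcongr; exact natCast_succ_le_two_pow n
    _ = _ := (mul_pow _ _ _).symm

lemma norm_homSum₃_le {M : ℝ} {A B C : ℂ} (hA : ‖A‖ ≤ M) (hB : ‖B‖ ≤ M) (hC : ‖C‖ ≤ M) (n : ℕ) :
    ‖homSum₃ A B C n‖ ≤ (4 * M) ^ n := by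
  have hM : 0 ≤ M := (norm_nonneg _).trans hB
  have h : homSum₃ A B C n =
      ∑ p ∈ Finset.HasAntidiagonal.antidiagonal n, A ^ p.1 * homSum₂ B C p.2 := by
    change ∑ p ∈ _, _ = _
    refine Finset.sum_congr rfl fun p _ => ?_
    change _ = A ^ p.1 * ∑ r ∈ _, _
    rw [Finset.mul_sum]
    simp only [mul_assoc]
  rw [h]
  calc _ ≤ ∑ p ∈ Finset.HasAntidiagonal.antidiagonal n, (2 * M) ^ n := by
        refine norm_sum_le_of_le _ fun p hp => ?_
        rw [← Finset.HasAntidiagonal.mem_antidiagonal.1 hp, pow_add, norm_mul, norm_pow]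
        gcongr
        · linarith
        · exact norm_homSum₂_le hB hC _
    _ = ((n : ℝ) + 1) * (2 * M) ^ n := by simp
    _ ≤ 2 ^ n * (2 * M) ^ n := by gcongr; exact natCast_succ_le_two_pow n
    _ = _ := by rw [← mul_pow]; congr 1; ring

lemma norm_homSum₂_le_of_le {M : ℝ} (hM : 1 ≤ M) {B C : ℂ} (hB : ‖B‖ ≤ M) (hC : ‖C‖ ≤ M)
    {z : ℤ} {l : ℕ} (hz : z ≤ l) : ‖homSum₂ B C z‖ ≤ (4 * M) ^ l := by
  rcases z with n | n
  · have hn : n ≤ l := by simpa using hz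
    calc _ ≤ (2 * M) ^ n := norm_homSum₂_le hB hC n
      _ ≤ (4 * M) ^ n := by gcongr; norm_num
      _ ≤ (4 * M) ^ l := by gcongr; linarith
  · simp only [homSum₂, norm_zero]
    positivity

lemma norm_homSum₃_le_of_le {M : ℝ} (hM : 1 ≤ M) {A B C : ℂ} (hA : ‖A‖ ≤ M) (hB : ‖B‖ ≤ M)
    (hC : ‖C‖ ≤ M) {z : ℤ} {l : ℕ} (hz : z ≤ l) : ‖homSum₃ A B C z‖ ≤ (4 * M) ^ l := by
  rcases z with n | n
  · have hn : n ≤ l := by simpa using hz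
    calc _ ≤ (4 * M) ^ n := norm_homSum₃_le hA hB hC n
      _ ≤ (4 * M) ^ l := by gcongr; linarith
  · simp only [homSum₃, norm_zero]
    positivity

lemma norm_chainF_le {M : ℝ} (hM : 1 ≤ M) {A B C : ℂ} (hA : ‖A‖ ≤ M) (hB : ‖B‖ ≤ M)
    (hC : ‖C‖ ≤ M) {z : ℤ} {l : ℕ} (hz : z ≤ l) :
    ‖chainF A B C z‖ ≤ 3 * M ^ 3 * (4 * M) ^ l := by
  have hM0 : 0 ≤ M := by linarith
  have h1 := norm_homSum₃_le_of_le hM hA hB hC hz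
  have h2 := norm_homSum₃_le_of_le hM hA hB hC (show z - 2 ≤ l by omega)
  have h3 := norm_homSum₂_le_of_le hM hB hC (show z - 1 ≤ l by omega)
  calc _ ≤ ‖homSum₃ A B C z‖ + ‖A * B * C * homSum₃ A B C (z - 2)‖ +
        ‖B * C * homSum₂ B C (z - 1)‖ := norm_add₃_le
    _ ≤ (4 * M) ^ l + M * M * M * (4 * M) ^ l + M * M * (4 * M) ^ l := by
      simp only [norm_mul]
      gcongr
    _ = (1 + M ^ 3 + M ^ 2) * (4 * M) ^ l := by ring
    _ ≤ _ := by
      gcongr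
      have e1 : 1 ≤ M ^ 3 := one_le_pow₀ hM
      have e2 : M ^ 2 ≤ M ^ 3 := pow_le_pow_right₀ hM (by norm_num)
      linarith

lemma norm_chainWeight_le {M : ℝ} (hM : 1 ≤ M) {A B C : ℂ} (hA : ‖A‖ ≤ M) (hB : ‖B‖ ≤ M)
    (hC : ‖C‖ ≤ M) (s l : ℕ) : ‖chainWeight A B C s l‖ ≤ (48 * M ^ 8) ^ l := by
  have hM0 : 0 ≤ M := by linarith
  rcases Nat.eq_zero_or_pos l with rfl | hl
  · simp [chainWeight_zero]
  have key : ‖chainWeight A B C s l‖ ≤ 12 * M ^ 7 * (4 * M) ^ l := by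
    rw [chainWeight]
    split_ifs
    · have h1 := norm_homSum₃_le_of_le hM hA hB hC (le_refl (l : ℤ))
      have h2 := norm_homSum₃_le_of_le hM hA hB hC (show (l : ℤ) - 2 ≤ l by omega)
      calc _ ≤ ‖homSum₃ A B C l‖ + ‖A * B * C * homSum₃ A B C (l - 2)‖ := norm_add_le _ _
        _ ≤ (4 * M) ^ l + M * M * M * (4 * M) ^ l := by
          simp only [norm_mul]
          gcongr
        _ = (1 + M ^ 3) * (4 * M) ^ l := by ring
        _ ≤ _ := by
          gcongr
          have e1 : 1 ≤ M ^ 7 := one_le_pow₀ hM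
          have e2 : M ^ 3 ≤ M ^ 7 := pow_le_pow_right₀ hM (by norm_num)
          linarith
    · have h1 := norm_chainF_le hM hA hB hC (le_refl (l : ℤ))
      have h2 := norm_chainF_le hM hA hB hC (show (l : ℤ) - 1 ≤ l by omega)
      have h3 := norm_chainF_le hM hA hB hC (show (l : ℤ) - 2 ≤ l by omega)
      have h4 : ‖B + C‖ ≤ M + M := norm_add_le_of_le hB hC
      calc _ ≤ ‖chainF A B C l‖ + ‖A * (B + C) * chainF A B C (l - 1)‖ +
            ‖A ^ 2 * B * C * chainF A B C (l - 2)‖ := norm_add₃_le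
        _ ≤ 3 * M ^ 3 * (4 * M) ^ l + M * (M + M) * (3 * M ^ 3 * (4 * M) ^ l) +
            M ^ 2 * M * M * (3 * M ^ 3 * (4 * M) ^ l) := by
          simp only [norm_mul, norm_pow]
          gcongr
        _ = (3 * M ^ 3 + 6 * M ^ 5 + 3 * M ^ 7) * (4 * M) ^ l := by ring
        _ ≤ _ := by
          gcongr
          have e1 : M ^ 3 ≤ M ^ 7 := pow_le_pow_right₀ hM (by norm_num)
          have e2 : M ^ 5 ≤ M ^ 7 := pow_le_pow_right₀ hM (by norm_num)
          linarith
  -- As l ≥ 1, the constant factor is absorbed into an l-th power, so that the bounds multiply over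
  -- chains.
  calc _ ≤ 12 * M ^ 7 * (4 * M) ^ l := key
    _ ≤ (12 * M ^ 7) ^ l * (4 * M) ^ l := by
      gcongr
      refine le_self_pow₀ ?_ hl.ne'
      have e1 : 1 ≤ M ^ 7 := one_le_pow₀ hM
      linarith
    _ = _ := by rw [← mul_pow]; congr 1; ring

/-- A subset of `{1, …, N}` is either everything, or its largest missing element splits it. -/
lemma eq_Ico_or_eq_union (N : ℕ) {S : Finset ℕ} (hS : S ⊆ Finset.Ico 1 (N + 1)) :
    S = Finset.Ico 1 (N + 1) ∨
      ∃ m < N, ∃ T ⊆ Finset.Ico 1 (m + 1), S = T ∪ Finset.Ico (m + 2) (N + 1) := by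
  induction N generalizing S with
  | zero => left; simpa using hS
  | succ N ih =>
    have h1 : ∀ m ≤ N + 1, Finset.Ico m (N + 1 + 1) = insert (N + 1) (Finset.Ico m (N + 1)) := by
      intro m hm
      ext x
      simp only [Finset.mem_insert, Finset.mem_Ico]
      omega
    rw [h1 1 (by omega)] at *
    by_cases hN : N + 1 ∈ S
    · have hS' : S.erase (N + 1) ⊆ Finset.Ico 1 (N + 1) := Finset.subset_insert_iff.1 hS
      rcases ih hS' with h | ⟨m, hm, T, hT, h⟩
      · left
        rw [← h, Finset.insert_erase hN]
      · right
        refine ⟨m, by omega, T, hT, ?_⟩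
        rw [h1 (m + 2) (by omega), Finset.union_insert, ← h, Finset.insert_erase hN]
    · right
      exact ⟨N, by omega, S, (Finset.subset_insert_iff_of_notMem hN).1 hS, by simp⟩

/-- Splitting off the top chain makes the exponents add up to the number of parts. -/
lemma norm_finsetWeight_le {M : ℝ} (hM : 1 ≤ M) {A B C : ℂ} (hA : ‖A‖ ≤ M) (hB : ‖B‖ ≤ M)
    (hC : ‖C‖ ≤ M) {N : ℕ} {S : Finset ℕ} (hS : S ⊆ Finset.Ico 1 (N + 1)) :
    ‖finsetWeight A B C S‖ ≤ (48 * M ^ 8) ^ S.card := by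
  induction N using Nat.strong_induction_on generalizing S with
  | _ N ih =>
    rcases eq_Ico_or_eq_union N hS with rfl | ⟨m, hm, T, hT, rfl⟩
    · rw [finsetWeight_Ico_one]
      simpa using norm_chainWeight_le hM hA hB hC 1 N
    · have hT' : ∀ x ∈ T, x + 1 < m + 2 := fun x hx => by
        have := (Finset.mem_Ico.1 (hT hx)).2
        omega
      obtain ⟨l, hl⟩ : ∃ l, N + 1 = m + 2 + l := ⟨N - 1 - m, by omega⟩
      rw [hl, finsetWeight_union_Ico _ _ _ _ hT', Finset.card_union_of_disjoint, norm_mul,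
        add_comm T.card, pow_add]
      · rw [Nat.card_Ico, Nat.add_sub_cancel_left]
        gcongr
        · exact norm_chainWeight_le hM hA hB hC _ _
        · exact ih m hm hT
      · rw [Finset.disjoint_left]
        intro x hx hx'
        have := hT' x hx
        have := (Finset.mem_Ico.1 hx').1
        omega

end Bounds

/-! ### Convergence, continuity and the infinite product -/

section Limit

/-- The contribution of a finite set of positive integers to the generating function, extended by
zero to all finite sets of natural numbers. -/
def finsetTerm (q A B C : ℂ) (S : Finset ℕ) : ℂ :=
  if 0 ∈ S then 0 else finsetWeight A B C S * q ^ (∑ i ∈ S, i)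

lemma norm_finsetTerm_le (q : ℂ) {M : ℝ} (hM : 1 ≤ M) {A B C : ℂ} (hA : ‖A‖ ≤ M) (hB : ‖B‖ ≤ M)
    (hC : ‖C‖ ≤ M) (S : Finset ℕ) :
    ‖finsetTerm q A B C S‖ ≤ ∏ i ∈ S, (48 * M ^ 8) * ‖q‖ ^ i := by
  rw [finsetTerm]
  split_ifs with h
  · rw [norm_zero]
    exact Finset.prod_nonneg fun i _ => by positivity
  · rw [Finset.prod_mul_distrib, Finset.prod_const, Finset.prod_pow_eq_pow_sum, norm_mul, norm_pow]
    gcongr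
    refine norm_finsetWeight_le hM hA hB hC (N := S.sup id) fun x hx => ?_
    have h1 : x ≤ S.sup id := Finset.le_sup (f := id) hx
    have h2 : x ≠ 0 := fun h0 => h (h0 ▸ hx)
    rw [Finset.mem_Ico]
    omega

lemma summable_finsetProd_mul_geometric {q : ℂ} (hq : ‖q‖ < 1) {K : ℝ} (hK : 0 ≤ K) :
    Summable fun S : Finset ℕ => ∏ i ∈ S, K * ‖q‖ ^ i :=
  summable_finsetProd_of_summable_nonneg (fun i => by positivity)
    ((summable_geometric_of_lt_one (norm_nonneg q) hq).mul_left K)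

/-- The generating function of all partitions into distinct parts. -/
noncomputable def distinctGF (q A B C : ℂ) : ℂ := ∑' S : Finset ℕ, finsetTerm q A B C S

lemma hasSum_finsetTerm {q : ℂ} (hq : ‖q‖ < 1) (A B C : ℂ) :
    HasSum (finsetTerm q A B C) (distinctGF q A B C) := by
  obtain ⟨M, hM, hA, hB, hC⟩ : ∃ M : ℝ, 1 ≤ M ∧ ‖A‖ ≤ M ∧ ‖B‖ ≤ M ∧ ‖C‖ ≤ M := by
    have := norm_nonneg A
    have := norm_nonneg B
    have := norm_nonneg C
    exact ⟨1 + ‖A‖ + ‖B‖ + ‖C‖, by linarith, by linarith, by linarith, by linarith⟩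
  exact (Summable.of_norm_bounded (summable_finsetProd_mul_geometric hq (by positivity))
    (norm_finsetTerm_le q hM hA hB hC)).hasSum

/-- The powersets of {0, …, N} are cofinal among finite families of finite sets, and sets containing
0 contribute nothing. -/
lemma tendsto_boundedGF {q : ℂ} (hq : ‖q‖ < 1) (A B C : ℂ) :
    Tendsto (boundedGF q A B C) atTop (𝓝 (distinctGF q A B C)) := by
  have h : Tendsto (fun s : Finset ℕ => ∑ S ∈ s.powerset, finsetTerm q A B C S) atTop
      (𝓝 (distinctGF q A B C)) := by
    have := hasSum_finsetTerm hq A B C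
    rw [HasSum, SummationFilter.unconditional_filter] at this
    exact this.comp tendsto_finset_powerset_atTop_atTop
  have h2 := (h.comp Filter.tendsto_finset_range).comp (tendsto_add_atTop_nat 1)
  refine h2.congr fun N => ?_
  change ∑ S ∈ (Finset.range (N + 1)).powerset, finsetTerm q A B C S = _
  rw [boundedGF]
  symm
  refine Finset.sum_subset_zero_on_sdiff (Finset.powerset_mono.2 ?_) ?_ ?_
  · intro x hx
    have := Finset.mem_Ico.1 hx
    exact Finset.mem_range.2 this.2
  · intro S hS
    obtain ⟨hS, hS'⟩ := Finset.mem_sdiff.1 hS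
    refine if_pos ?_
    by_contra h0
    refine hS' (Finset.mem_powerset.2 fun x hx => ?_)
    have h1 := Finset.mem_range.1 (Finset.mem_powerset.1 hS hx)
    have h2 : x ≠ 0 := fun h => h0 (h ▸ hx)
    exact Finset.mem_Ico.2 ⟨by omega, h1⟩
  · intro S hS
    refine (if_neg fun h0 => ?_).symm
    have := Finset.mem_Ico.1 (Finset.mem_powerset.1 hS h0)
    omega

lemma continuous_homSum₂ (z : ℤ) : Continuous fun x : ℂ × ℂ × ℂ => homSum₂ x.2.1 x.2.2 z := by
  rcases z with n | n
  · simp only [homSum₂]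
    fun_prop
  · exact continuous_const

lemma continuous_homSum₃ (z : ℤ) : Continuous fun x : ℂ × ℂ × ℂ => homSum₃ x.1 x.2.1 x.2.2 z := by
  rcases z with n | n
  · simp only [homSum₃]
    fun_prop
  · exact continuous_const

lemma continuous_chainF (z : ℤ) : Continuous fun x : ℂ × ℂ × ℂ => chainF x.1 x.2.1 x.2.2 z := by
  have h1 := continuous_homSum₃ z
  have h2 := continuous_homSum₃ (z - 2)
  have h3 := continuous_homSum₂ (z - 1)
  simp only [chainF]
  fun_prop

lemma continuous_chainWeight (s l : ℕ) :
    Continuous fun x : ℂ × ℂ × ℂ => chainWeight x.1 x.2.1 x.2.2 s l := by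
  have h1 := continuous_homSum₃ l
  have h2 := continuous_homSum₃ ((l : ℤ) - 2)
  have h3 := continuous_chainF l
  have h4 := continuous_chainF ((l : ℤ) - 1)
  have h5 := continuous_chainF ((l : ℤ) - 2)
  simp only [chainWeight]
  split_ifs <;> fun_prop

lemma continuous_finsetTerm (q : ℂ) (S : Finset ℕ) :
    Continuous fun x : ℂ × ℂ × ℂ => finsetTerm q x.1 x.2.1 x.2.2 S := by
  simp only [finsetTerm, finsetWeight]
  split_ifs
  · exact continuous_const
  · exact (continuous_finsetProd _ fun c _ => continuous_chainWeight c.1 c.2).mul continuous_const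

lemma continuous_distinctGF {q : ℂ} (hq : ‖q‖ < 1) :
    Continuous fun x : ℂ × ℂ × ℂ => distinctGF q x.1 x.2.1 x.2.2 := by
  rw [continuous_iff_continuousAt]
  intro x
  refine tendsto_tsum_of_dominated_convergence
    -- The value M = ‖x‖ + 1 bounds all three parameters throughout a neighbourhood of x.
    (summable_finsetProd_mul_geometric hq (K := 48 * (‖x‖ + 1) ^ 8) (by positivity))
    (fun S => (continuous_finsetTerm q S).continuousAt) ?_
  filter_upwards [continuous_norm.continuousAt.eventually_lt continuousAt_const
    (lt_add_one ‖x‖)] with y hy S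
  have hy1 := norm_fst_le y
  have hy2 := norm_snd_le y
  have hy3 := norm_fst_le y.2
  have hy4 := norm_snd_le y.2
  have := norm_nonneg x
  exact norm_finsetTerm_le q (by linarith) (by linarith) (by linarith) (by linarith) S

lemma tendsto_qPochhammer {q : ℂ} (hq : ‖q‖ < 1) (a : ℂ) :
    Tendsto (fun N : ℕ => qPochhammer a q N) atTop (𝓝 (qPochhammerInf a q)) := by
  have hs : Summable fun j : ℕ => ‖-(a * q ^ j)‖ := by
    simp only [norm_neg, norm_mul, norm_pow]
    exact (summable_geometric_of_lt_one (norm_nonneg q) hq).mul_left _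
  have h := (multipliable_one_add_of_summable hs).hasProd.tendsto_prod_nat
  simp only [← sub_eq_add_neg] at h
  exact tendsto_nhds_limUnder ⟨_, h⟩

/-- A continuous solution of `F(c) = (1 + c q) F(c q)` is determined by `F(0)`. -/
lemma eq_qPochhammerInf_mul {q : ℂ} (hq : ‖q‖ < 1) {F : ℂ → ℂ} (hF : Continuous F)
    (h : ∀ c, F c = (1 + c * q) * F (c * q)) (c : ℂ) :
    F c = qPochhammerInf (-c * q) q * F 0 := by
  have key : ∀ m : ℕ, F c = qPochhammer (-c * q) q m * F (c * q ^ m) := by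
    intro m
    induction m with
    | zero => simp [qPochhammer]
    | succ m ih =>
      rw [ih, h (c * q ^ m), qPochhammer, qPochhammer, Finset.prod_range_succ, pow_succ,
        ← mul_assoc c]
      ring
  have t : Tendsto (fun m : ℕ => c * q ^ m) atTop (𝓝 0) := by
    simpa using (tendsto_pow_atTop_nhds_zero_of_norm_lt_one hq).const_mul c
  have t2 := (tendsto_qPochhammer hq (-c * q)).mul ((hF.tendsto 0).comp t)
  exact tendsto_nhds_unique tendsto_const_nhds (t2.congr fun m => (key m).symm)

lemma distinctGF_shift {q : ℂ} (hq : ‖q‖ < 1) (A B C : ℂ) :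
    distinctGF q A B C = (1 + C * q) * distinctGF q A B (C * q) :=
  (boundedGF_shiftEquation q A B C).limit_eq hq (boundedGF_shiftEquation q A B (C * q))
    (tendsto_boundedGF hq _ _ _) (tendsto_boundedGF hq _ _ _)

lemma distinctGF_shift₂ {q : ℂ} (hq : ‖q‖ < 1) (A B C : ℂ) :
    distinctGF q A B C = (1 + B * q) * distinctGF q A (B * q) C :=
  (boundedGF_shiftEquation q A B C).swap₂₃.limit_eq hq
    (boundedGF_shiftEquation q A (B * q) C).swap₂₃
    (tendsto_boundedGF hq _ _ _) (tendsto_boundedGF hq _ _ _)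

lemma distinctGF_shift₁ {q : ℂ} (hq : ‖q‖ < 1) (A B C : ℂ) :
    distinctGF q A B C = (1 + A * q) * distinctGF q (A * q) B C :=
  (boundedGF_shiftEquation q A B C).swap₁₂.swap₂₃.limit_eq hq
    (boundedGF_shiftEquation q (A * q) B C).swap₁₂.swap₂₃
    (tendsto_boundedGF hq _ _ _) (tendsto_boundedGF hq _ _ _)

lemma distinctGF_eq {q : ℂ} (hq : ‖q‖ < 1) (A B C : ℂ) :
    distinctGF q A B C =
      qPochhammerInf (-A * q) q * qPochhammerInf (-B * q) q * qPochhammerInf (-C * q) q := by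
  have hc := continuous_distinctGF hq
  have c3 : Continuous fun c => distinctGF q A B c := by
    have h := hc.comp (by fun_prop : Continuous fun c : ℂ => (A, B, c))
    exact h
  have c2 : Continuous fun b => distinctGF q A b 0 := by
    have h := hc.comp (by fun_prop : Continuous fun b : ℂ => (A, b, (0 : ℂ)))
    exact h
  have c1 : Continuous fun a => distinctGF q a 0 0 := by
    have h := hc.comp (by fun_prop : Continuous fun a : ℂ => (a, (0 : ℂ), (0 : ℂ)))
    exact h
  have h3 := eq_qPochhammerInf_mul hq c3 (fun c => distinctGF_shift hq A B c) C
  have h2 := eq_qPochhammerInf_mul hq c2 (fun b => distinctGF_shift₂ hq A b 0) B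
  have h1 := eq_qPochhammerInf_mul hq c1 (fun a => distinctGF_shift₁ hq a 0 0) A
  have h0 : distinctGF q 0 0 0 = 1 :=
    tendsto_nhds_unique (tendsto_boundedGF hq 0 0 0)
      (tendsto_const_nhds.congr fun n => ((boundedGF_shiftEquation q 0 0 0).eq_one n).symm)
  rw [h3, h2, h1, h0]
  ring

end Limit

/-! ### From finite sets to partitions -/

section Partitions

/-- The set of parts of a partition. -/
def DistinctPartition.partsFinset (π : DistinctPartition) : Finset ℕ := π.2.1.parts.toFinset

lemma DistinctPartition.partsFinset_val (π : DistinctPartition) :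
    π.partsFinset.val = π.2.1.parts :=
  Multiset.dedup_eq_self.2 (Finset.mem_filter.1 π.2.2).2

lemma DistinctPartition.partsFinset_injective :
    Function.Injective DistinctPartition.partsFinset := by
  intro π ρ h
  have h1 : π.2.1.parts = ρ.2.1.parts := by
    rw [← π.partsFinset_val, ← ρ.partsFinset_val, h]
  obtain ⟨n, p, hp⟩ := π
  obtain ⟨m, r, hr⟩ := ρ
  simp only at h1
  obtain rfl : n = m := by rw [← p.parts_sum, ← r.parts_sum, h1]
  obtain rfl : p = r := Nat.Partition.ext h1
  rfl

lemma DistinctPartition.zero_notMem_partsFinset (π : DistinctPartition) : 0 ∉ π.partsFinset := by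
  intro h
  exact (π.2.1.parts_pos (Multiset.mem_toFinset.1 h)).ne rfl

lemma DistinctPartition.exists_partsFinset_eq {S : Finset ℕ} (hS : 0 ∉ S) :
    ∃ π : DistinctPartition, π.partsFinset = S := by
  refine ⟨⟨S.val.sum, ⟨S.val, fun {i} hi => Nat.pos_of_ne_zero fun h => hS (h ▸ hi), rfl⟩, ?_⟩, ?_⟩
  · exact Finset.mem_filter.2 ⟨Finset.mem_univ _, S.nodup⟩
  · exact S.val_toFinset

lemma DistinctPartition.finsetTerm_partsFinset (q A B C : ℂ) (π : DistinctPartition) :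
    finsetTerm q A B C π.partsFinset = π.weight A B C * q ^ π.size := by
  rw [finsetTerm, if_neg π.zero_notMem_partsFinset, DistinctPartition.size, ← π.partsFinset_val,
    Finset.sum_val]
  rfl

end Partitions

theorem corollary1 (A B C q : ℂ) (hq : ‖q‖ < 1) :
    (∀ a : ℂ, Tendsto (fun N : ℕ => qPochhammer a q N) atTop (𝓝 (qPochhammerInf a q))) ∧
    HasSum (fun π : DistinctPartition => π.weight A B C * q ^ π.size)
      (qPochhammerInf (-A * q) q * qPochhammerInf (-B * q) q * qPochhammerInf (-C * q) q) := by
  refine ⟨tendsto_qPochhammer hq, ?_⟩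
  have h := hasSum_finsetTerm hq A B C
  -- Sets that are not sets of parts contain 0, so their terms vanish.
  rw [distinctGF_eq hq, ← DistinctPartition.partsFinset_injective.hasSum_iff] at h
  · exact h.congr_fun fun π => (DistinctPartition.finsetTerm_partsFinset q A B C π).symm
  · intro S hS
    refine if_pos ?_
    by_contra h0
    exact hS (DistinctPartition.exists_partsFinset_eq h0)
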